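/- Let $d\ge 1$. Let $\Omega\subset\mathbb{R}^d$ be open and bounded with Lipschitz boundary (near each boundary point, $\Omega$ is, in suitable Cartesian coordinates, the set strictly above the graph of a Lipschitz function), and suppose that $\Omega$ satisfies an interior cone condition: there are a radius $\mathcal{R}>0$ and an angle $\nu\in(0,\pi/2)$ such that for every $x\in\Omega$ there is a unit vector $\xi$ with $\{x+ty : 0\le t\le \mathcal{R},\ \|y\|=1,\ y\cdot\xi\ge\cos\nu\}\subset\Omega$. Then there is a finite constant $C_P$ depending only on the shape and size of $\Omega$ (that is, only on $\Omega$ up to congruence) with the following property. Let $m\ge 2$ be an integer and let $u\in W^m_\infty(\Omega)$ be real-valued, i.e. all weak derivatives of $u$ of order at most $m$ exist and belong to $L_\infty(\Omega)$. Suppose that $u$ solves $$-\Delta u=f \ \text{ in } \Omega,\qquad u=g \ \text{ on } \partial\Omega,$$ for some functions $f$ on $\Omega$ and $g$ on $\partial\Omega$, where the equation holds almost everywhere in $\Omega$ and the boundary values are taken in the sense of traces: $\lim_{r\to0^+}\frac{1}{|\Omega\cap B(x,r)|}\int_{\Omega\cap B(x,r)}|u(y)-g(x)|\,dy=0$ for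 almost every $x\in\partial\Omega$ with respect to the surface measure. Then $$\|u\|_{L_2(\Omega)}\le C_P\,\max\bigl(\|\Delta u\|_{L_\infty(\Omega)},\ \|u\|_{L_\infty(\partial\Omega)}\bigr),$$ where $\|u\|_{L_\infty(\partial\Omega)}$ is the essential supremum, with respect to the surface measure, of the absolute value of the trace of $u$ on $\partial\Omega$. -/

import Mathlib

open MeasureTheory Filter Topology Set
open scoped ENNReal NNReal ContDiff

noncomputable section

namespace PoissonEstimate

/-- `ℝ^d` with the Euclidean norm. -/
abbrev E (d : ℕ) := EuclideanSpace ℝ (Fin d)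

variable {d : ℕ}

/-! ### Domains -/

/-- `∂Ω` is Lipschitz: near each boundary point, `Ω` is the set strictly above the graph of a
Lipschitz function `γ`, in a direction `e` (a unit vector). The function `γ` is only evaluated at
`y - ⟨e, y⟩ e`, the orthogonal projection of `y` to the hyperplane `e^⊥`. -/
def HasLipschitzBoundary (Ω : Set (E d)) : Prop :=
  ∀ x ∈ frontier Ω, ∃ r : ℝ, 0 < r ∧ ∃ e : E d, ‖e‖ = 1 ∧
    ∃ (K : ℝ≥0) (γ : E d → ℝ), LipschitzWith K γ ∧
      Ω ∩ Metric.ball x r =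
        {y | γ (y - inner ℝ e y • e) < inner ℝ e y} ∩ Metric.ball x r

/-- The cone with vertex `x`, axis direction `ξ`, angle `ν` and radius `R`. -/
def cone (x ξ : E d) (ν R : ℝ) : Set (E d) :=
  {z | ∃ (y : E d) (t : ℝ), ‖y‖ = 1 ∧ Real.cos ν ≤ inner ℝ y ξ ∧ t ∈ Icc 0 R ∧ z = x + t • y}

/-- Interior cone condition with radius `R` and angle `ν`. -/
def InteriorConeCondition (Ω : Set (E d)) (R ν : ℝ) : Prop :=
  ∀ x ∈ Ω, ∃ ξ : E d, ‖ξ‖ = 1 ∧ cone x ξ ν R ⊆ Ω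

/-- Open bounded sets with Lipschitz boundary that satisfy an interior cone condition. -/
structure IsAdmissibleDomain (Ω : Set (E d)) : Prop where
  isOpen : IsOpen Ω
  isBounded : Bornology.IsBounded Ω
  lipschitz : HasLipschitzBoundary Ω
  cone : ∃ R ν : ℝ, 0 < R ∧ 0 < ν ∧ ν < Real.pi / 2 ∧ InteriorConeCondition Ω R ν

/-! ### Weak derivatives and Sobolev spaces -/

/-- The classical partial derivative `∂φ/∂x_i`. -/
def partialDeriv (i : Fin d) (φ : E d → ℝ) : E d → ℝ :=
  fun x => fderiv ℝ φ x (EuclideanSpace.single i 1)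

/-- The classical derivative `∂^|α| φ / ∂x^α` for a multi-index `α`. -/
def multiDeriv (α : Fin d → ℕ) (φ : E d → ℝ) : E d → ℝ :=
  (List.finRange d).foldr (fun i ψ => (partialDeriv i)^[α i] ψ) φ

/-- `φ ∈ C_c^∞(Ω)`. -/
structure IsTestFunction (Ω : Set (E d)) (φ : E d → ℝ) : Prop where
  smooth : ContDiff ℝ ∞ φ
  compact : HasCompactSupport φ
  support : tsupport φ ⊆ Ω

/-- `v` is the weak derivative of `u` in `Ω` for the multi-index `α`. -/
structure HasWeakDeriv (Ω : Set (E d)) (α : Fin d → ℕ) (u v : E d → ℝ) : Prop where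
  left : LocallyIntegrableOn u Ω
  right : LocallyIntegrableOn v Ω
  integral_eq : ∀ φ : E d → ℝ, IsTestFunction Ω φ →
    ∫ x in Ω, u x * multiDeriv α φ x = (-1) ^ (∑ i, α i) * ∫ x in Ω, v x * φ x

/-- `u ∈ W_p^k(Ω)`: all weak derivatives of order at most `k` exist and lie in `L_p(Ω)`. -/
structure MemSobolev (Ω : Set (E d)) (k : ℕ) (p : ℝ≥0∞) (u : E d → ℝ) : Prop where
  memLp : MemLp u p (volume.restrict Ω)
  deriv : ∀ α : Fin d → ℕ, ∑ i, α i ≤ k →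
    ∃ v : E d → ℝ, HasWeakDeriv Ω α u v ∧ MemLp v p (volume.restrict Ω)

open Classical in
/-- The weak derivative of `u` (unique a.e. in an open `Ω`); zero if there is none. -/
def weakDeriv (Ω : Set (E d)) (α : Fin d → ℕ) (u : E d → ℝ) : E d → ℝ :=
  if h : ∃ v, HasWeakDeriv Ω α u v then h.choose else 0

/-- The Laplacian `Δu = ∑ i, ∂²u/∂x_i²`, in the sense of weak derivatives in `Ω`. -/
def weakLaplacian (Ω : Set (E d)) (u : E d → ℝ) : E d → ℝ :=
  fun x => ∑ i, weakDeriv Ω (Pi.single i 2) u x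

/-! ### Boundary values -/

/-- Surface measure on `∂Ω`: the `(d-1)`-dimensional Hausdorff measure. -/
def surfaceMeasure (Ω : Set (E d)) : Measure (E d) :=
  (Measure.hausdorffMeasure ((d : ℝ) - 1)).restrict (frontier Ω)

/-- `u = g` on `∂Ω` in the sense of traces: at almost every boundary point `x`, the mean of
`|u - g(x)|` over `Ω ∩ B(x, r)` tends to `0` as `r → 0`. If `u` is continuous up to the boundary,
this says that `u = g` almost everywhere on `∂Ω`. -/
def HasTrace (Ω : Set (E d)) (u g : E d → ℝ) : Prop :=
  ∀ᵐ x ∂(surfaceMeasure Ω),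
    Tendsto (fun r : ℝ => ⨍⁻ y in Ω ∩ Metric.ball x r, ‖u y - g x‖ₑ ∂volume) (𝓝[>] 0) (𝓝 0)

open Classical in
/-- The boundary values of `u` (unique a.e. on `∂Ω`); zero if there are none. -/
def boundaryTrace (Ω : Set (E d)) (u : E d → ℝ) : E d → ℝ :=
  if h : ∃ g, HasTrace Ω u g then h.choose else 0

/-! ### The Poisson problem -/

/-- `-Δu = f` in `Ω`, `u = g` on `∂Ω`. -/
structure IsPoissonSolution (Ω : Set (E d)) (f g u : E d → ℝ) : Prop where
  interior : ∀ᵐ x ∂(volume.restrict Ω), -weakLaplacian Ω u x = f x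
  boundary : HasTrace Ω u g

/-- The data norm `‖u‖_F = max (‖Δu‖_{L_∞(Ω)}) (‖u‖_{L_∞(∂Ω)})`. -/
def dataNorm (Ω : Set (E d)) (u : E d → ℝ) : ℝ≥0∞ :=
  max (eLpNorm (weakLaplacian Ω u) ∞ (volume.restrict Ω))
    (eLpNorm (boundaryTrace Ω u) ∞ (surfaceMeasure Ω))

end PoissonEstimate

end

/-!
A bounded weak gradient makes `u` a.e. equal to a function `U` that is Lipschitz along the segments
in `Ω`: mollify `u` and pass to the limit. Above a Lipschitz graph, any two points are joined by
polygonal paths of comparable length, so `U` is uniformly continuous near each boundary point. Since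
the surface measure charges every ball centred on `∂Ω`, a bound on the trace that holds almost
everywhere becomes a bound for `U` at all boundary points.

If `A` exceeds `sup |Δu| / (2d)`, then adding `A ‖y - x‖²` to a mollification of `U` gives a
function of `y` with positive Laplacian, which has no interior maximum. Hence
`|u| ≤ sup_∂Ω |u| + diam² Ω / (2d) · sup |Δu|`, which bounds the `L_p` norm because `Ω` is bounded.
-/

noncomputable section

namespace PoissonEstimate

variable {d : ℕ}

/-! ### The maximum principle -/

section MaximumPrinciple

open Module Laplacian

variable {F : Type*} [NormedAddCommGroup F]

theorem deriv_deriv_nonpos_of_isLocalMax {h : ℝ → ℝ} {t : ℝ} (hmax : IsLocalMax h t)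
    (hc : ContinuousAt h t) : deriv (deriv h) t ≤ 0 := by
  by_contra! hpos
  have hmin : IsLocalMin h t := isLocalMin_of_deriv_deriv_pos hpos hmax.deriv_eq_zero hc
  have hconst : h =ᶠ[𝓝 t] fun _ => h t := by
    filter_upwards [hmin, hmax] with s hle hge using le_antisymm hge hle
  simp [hconst.deriv.deriv_eq] at hpos

variable [InnerProductSpace ℝ F]

theorem deriv_deriv_comp_add_smul {f : F → ℝ} (hf : ContDiff ℝ 2 f) (p e : F) :
    deriv (deriv fun t : ℝ => f (p + t • e)) 0 = iteratedFDeriv ℝ 2 f p ![e, e] := by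
  have hline (t : ℝ) : HasDerivAt (fun t : ℝ => p + t • e) e t := by
    simpa using ((hasDerivAt_id t).smul_const e).const_add p
  have hderiv : (deriv fun t : ℝ => f (p + t • e)) = fun t => fderiv ℝ f (p + t • e) e :=
    funext fun t =>
      ((hf.differentiable two_ne_zero _).hasFDerivAt.comp_hasDerivAt t (hline t)).deriv
  have hdiff : Differentiable ℝ (fderiv ℝ f) :=
    (hf.fderiv_right (m := 1) (by norm_num)).differentiable one_ne_zero
  have hderiv₂ : HasDerivAt (fun t : ℝ => fderiv ℝ f (p + t • e))
      (fderiv ℝ (fderiv ℝ f) (p + (0 : ℝ) • e) e) 0 :=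
    (hdiff _).hasFDerivAt.comp_hasDerivAt 0 (hline 0)
  rw [hderiv, iteratedFDeriv_two_apply, (hderiv₂.clm_apply (hasDerivAt_const 0 e)).deriv]
  simp

variable [FiniteDimensional ℝ F]

theorem laplacian_nonpos_of_isLocalMax {f : F → ℝ} (hf : ContDiff ℝ 2 f) {p : F}
    (hmax : IsLocalMax f p) : Δ f p ≤ 0 := by
  rw [InnerProductSpace.laplacian_eq_iteratedFDeriv_stdOrthonormalBasis]
  refine Finset.sum_nonpos fun i _ => ?_
  set e := stdOrthonormalBasis ℝ F i
  have hline : Continuous fun t : ℝ => p + t • e := by fun_prop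
  have htend : Tendsto (fun t : ℝ => p + t • e) (𝓝 0) (𝓝 p) := by simpa using hline.tendsto 0
  rw [← deriv_deriv_comp_add_smul hf]
  refine deriv_deriv_nonpos_of_isLocalMax ?_ (hf.continuous.comp hline).continuousAt
  simpa [IsLocalMax, IsMaxFilter] using htend.eventually hmax

theorem laplacian_norm_sub_sq (x p : F) :
    Δ (fun y : F => ‖y - x‖ ^ 2) p = 2 * finrank ℝ F := by
  have hfderiv : fderiv ℝ (fun y : F => ‖y - x‖ ^ 2) = fun y => (2 : ℝ) • innerSL ℝ (y - x) :=
    funext fun y => (((hasFDerivAt_id y).sub_const x).norm_sq.fderiv).trans <| by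
      ext v; simp [two_smul]
  have hfderiv₂ (v : F) :
      fderiv ℝ (fun y : F => (2 : ℝ) • innerSL ℝ (y - x)) p v v = 2 * inner ℝ v v :=
    congrArg (fun T : F →L[ℝ] F →L[ℝ] ℝ => T v v) (((innerSL ℝ).hasFDerivAt.comp p
      ((hasFDerivAt_id p).sub_const x)).const_smul (2 : ℝ)).fderiv
  simp only [InnerProductSpace.laplacian_eq_iteratedFDeriv_stdOrthonormalBasis,
    iteratedFDeriv_two_apply, hfderiv, Matrix.cons_val_zero, Matrix.cons_val_one, hfderiv₂]
  simp [mul_comm]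

theorem exists_mem_frontier_le_add_mul_norm_sub_sq {K : Set F} (hK : IsCompact K) {W : F → ℝ}
    (hW : ContDiff ℝ 2 W) {A : ℝ} (hΔ : ∀ y ∈ K, -(2 * finrank ℝ F * A) < Δ W y) {x : F}
    (hx : x ∈ K) : ∃ p ∈ frontier K, W x ≤ W p + A * ‖p - x‖ ^ 2 := by
  have hq : ContDiff ℝ 2 fun y : F => ‖y - x‖ ^ 2 := (contDiff_id.sub contDiff_const).norm_sq ℝ
  have hAq : ContDiff ℝ 2 (A • fun y : F => ‖y - x‖ ^ 2) := hq.const_smul A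
  have hw : ContDiff ℝ 2 (W + A • fun y => ‖y - x‖ ^ 2) := hW.add hAq
  obtain ⟨p, hpK, hpmax⟩ := hK.exists_isMaxOn ⟨x, hx⟩ hw.continuous.continuousOn
  refine ⟨p, hK.isClosed.frontier_eq ▸ ⟨hpK, fun hpint => ?_⟩, by simpa using hpmax hx⟩
  have hle := laplacian_nonpos_of_isLocalMax hw
    (hpmax.isLocalMax (mem_interior_iff_mem_nhds.1 hpint))
  rw [hW.contDiffAt.laplacian_add hAq.contDiffAt,
    InnerProductSpace.laplacian_smul A hq.contDiffAt, laplacian_norm_sub_sq, smul_eq_mul] at hle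
  linarith [hΔ p hpK]

theorem isClosed_inter_superlevel {X : Type*} [TopologicalSpace X] {Ω : Set X} (hΩ : IsOpen Ω)
    {V : X → ℝ} (hV : ContinuousOn V Ω) {c : ℝ}
    (hbd : ∀ x ∈ frontier Ω, ∀ᶠ y in 𝓝[Ω] x, V y < c) : IsClosed {y ∈ Ω | c ≤ V y} := by
  refine isClosed_of_closure_subset fun y hy => ?_
  rw [mem_closure_iff_frequently] at hy
  by_cases hyΩ : y ∈ Ω
  · exact ⟨hyΩ, ge_of_tendsto_of_frequently (hV.continuousAt (hΩ.mem_nhds hyΩ))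
      (hy.mono fun z hz => hz.2)⟩
  · have hyf : y ∈ frontier Ω :=
      hΩ.frontier_eq ▸ ⟨mem_closure_iff_frequently.2 (hy.mono fun z hz => hz.1), hyΩ⟩
    obtain ⟨z, hz, hzlt⟩ := (hy.and_eventually (eventually_nhdsWithin_iff.1 (hbd y hyf))).exists
    exact absurd (hzlt hz.1) hz.2.not_gt

theorem le_add_mul_diam_sq_of_smooth_approx [Nontrivial F] {Ω : Set F} (hΩ : IsOpen Ω)
    (hb : Bornology.IsBounded Ω) {V : F → ℝ} (hV : ContinuousOn V Ω) {C G : ℝ} (hC : 0 ≤ C)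
    (happ : ∀ K ⊆ Ω, IsCompact K → ∀ η > 0, ∃ W : F → ℝ, ContDiff ℝ 2 W ∧
      ∀ y ∈ K, |W y - V y| ≤ η ∧ -C ≤ Δ W y)
    (hbd : ∀ x ∈ frontier Ω, ∀ c > G, ∀ᶠ y in 𝓝[Ω] x, V y < c) {x : F} (hx : x ∈ Ω) :
    V x ≤ G + C / (2 * finrank ℝ F) * Metric.diam Ω ^ 2 := by
  have hdim : 0 < (2 * finrank ℝ F : ℝ) := by
    have := finrank_pos (R := ℝ) (M := F)
    positivity
  set D := Metric.diam Ω
  set A₀ := C / (2 * finrank ℝ F)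
  have : 0 ≤ A₀ := by positivity
  have hle : ∀ η > 0, V x ≤ G + 3 * η + (A₀ + η) * D ^ 2 := by
    intro η hη
    rcases lt_or_ge (V x) (G + η) with hxG | hxG
    · linarith [show 0 ≤ (A₀ + η) * D ^ 2 by positivity]
    set K : Set F := {y ∈ Ω | G + η ≤ V y}
    have hKΩ : K ⊆ Ω := sep_subset _ _
    have hK : IsCompact K := Metric.isCompact_of_isClosed_isBounded
      (isClosed_inter_superlevel hΩ hV fun y hy => hbd y hy _ (by linarith)) (hb.subset hKΩ)
    obtain ⟨δ, hδ, hδΩ⟩ := hK.exists_cthickening_subset_open hΩ hKΩ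
    have hxK : x ∈ Metric.cthickening δ K := Metric.self_subset_cthickening K ⟨hx, hxG⟩
    obtain ⟨W, hW, hWK⟩ := happ _ hδΩ hK.cthickening η hη
    have hΔ : ∀ y ∈ Metric.cthickening δ K, -(2 * finrank ℝ F * (A₀ + η)) < Δ W y := fun y hy => by
      have : 2 * finrank ℝ F * A₀ = C := mul_div_cancel₀ C hdim.ne'
      linarith [(hWK y hy).2, mul_pos hdim hη]
    obtain ⟨p, hpf, hxp⟩ := exists_mem_frontier_le_add_mul_norm_sub_sq hK.cthickening hW hΔ hxK
    have hpK' : p ∈ Metric.cthickening δ K := hK.cthickening.isClosed.frontier_subset hpf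
    have hpV : V p < G + η := by
      by_contra! hpK
      refine hpf.2 (mem_interior.2 ⟨_, Metric.thickening_subset_cthickening δ K,
        Metric.isOpen_thickening, Metric.self_subset_thickening hδ K ⟨hδΩ hpK', hpK⟩⟩)
    have hsq : (A₀ + η) * ‖p - x‖ ^ 2 ≤ (A₀ + η) * D ^ 2 := by
      gcongr
      exact dist_eq_norm p x ▸ Metric.dist_le_diam_of_mem hb (hδΩ hpK') hx
    linarith [(abs_le.1 (hWK p hpK').1).2, (abs_le.1 (hWK x hxK).1).1]
  have hlim : Tendsto (fun η : ℝ => G + 3 * η + (A₀ + η) * D ^ 2) (𝓝[>] 0)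
      (𝓝 (G + A₀ * D ^ 2)) := by
    have : Continuous fun η : ℝ => G + 3 * η + (A₀ + η) * D ^ 2 := by fun_prop
    simpa using (this.tendsto 0).mono_left nhdsWithin_le_nhds
  exact ge_of_tendsto hlim (eventually_mem_nhdsWithin.mono hle)

end MaximumPrinciple

/-! ### Lipschitz epigraphs -/

section Epigraph

variable {F : Type*} [NormedAddCommGroup F] [InnerProductSpace ℝ F] {e : F} {γ : F → ℝ}

/-- The region strictly above the graph of `γ` over the hyperplane `e^⊥`. As in
`HasLipschitzBoundary`, `γ` is defined on the whole space but only its values on `e^⊥` matter. -/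
def strictEpigraph (e : F) (γ : F → ℝ) : Set F :=
  {y | γ (y - inner ℝ e y • e) < inner ℝ e y}

theorem coe_orthogonalProjectionOnto_orthogonal_span_singleton (he : ‖e‖ = 1) (y : F) :
    ((ℝ ∙ e)ᗮ.orthogonalProjectionOnto y : F) = y - inner ℝ e y • e := by
  simp only [Submodule.orthogonalProjectionOnto_orthogonal,
    Submodule.starProjection_unit_singleton ℝ he]

theorem norm_sub_inner_smul_le (he : ‖e‖ = 1) (y : F) : ‖y - inner ℝ e y • e‖ ≤ ‖y‖ := by
  rw [← coe_orthogonalProjectionOnto_orthogonal_span_singleton he]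
  exact Submodule.norm_orthogonalProjectionOnto_apply_le _ y

theorem add_smul_sub_inner_smul (he : ‖e‖ = 1) (y : F) (s : ℝ) :
    y + s • e - inner ℝ e (y + s • e) • e = y - inner ℝ e y • e := by
  rw [inner_add_right, inner_smul_right, real_inner_self_eq_norm_sq, he]
  module

theorem add_smul_mem_strictEpigraph_iff (he : ‖e‖ = 1) (y : F) (s : ℝ) :
    y + s • e ∈ strictEpigraph e γ ↔ γ (y - inner ℝ e y • e) < inner ℝ e y + s := by
  rw [strictEpigraph, mem_ofPred_eq, add_smul_sub_inner_smul he, inner_add_right,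
    inner_smul_right, real_inner_self_eq_norm_sq, he, one_pow, mul_one]

section Lipschitz

variable {K : ℝ≥0}

theorem add_smul_mem_strictEpigraph (he : ‖e‖ = 1) (hγ : LipschitzWith K γ) {y z : F} {s : ℝ}
    (hy : y ∈ strictEpigraph e γ) (hs : (K + 1) * ‖z - y‖ ≤ s) :
    z + s • e ∈ strictEpigraph e γ := by
  have hγ' : γ (z - inner ℝ e z • e) - γ (y - inner ℝ e y • e) ≤ K * ‖z - y‖ :=
    calc
      _ ≤ dist (γ (z - inner ℝ e z • e)) (γ (y - inner ℝ e y • e)) := le_abs_self _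
      _ ≤ K * ‖(z - inner ℝ e z • e) - (y - inner ℝ e y • e)‖ := hγ.dist_le_mul_of_le
        (dist_eq_norm _ _).le
      _ = K * ‖(z - y) - inner ℝ e (z - y) • e‖ := by rw [inner_sub_right]; congr 2; module
      _ ≤ K * ‖z - y‖ := by gcongr; exact norm_sub_inner_smul_le he _
  have hinner : |inner ℝ e z - inner ℝ e y| ≤ ‖z - y‖ := by
    simpa [he, inner_sub_right] using abs_real_inner_le_norm e (z - y)
  have hy' : γ (y - inner ℝ e y • e) < inner ℝ e y := hy
  rw [add_smul_mem_strictEpigraph_iff he]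
  linarith [(abs_le.1 hinner).1]

theorem segment_self_add_smul_subset_strictEpigraph (he : ‖e‖ = 1) {y : F} {s : ℝ}
    (hy : y ∈ strictEpigraph e γ) (hs : 0 ≤ s) : segment ℝ y (y + s • e) ⊆ strictEpigraph e γ := by
  rintro _ ⟨a, b, -, hb, hab, rfl⟩
  have hy' : γ (y - inner ℝ e y • e) < inner ℝ e y := hy
  rw [show a • y + b • (y + s • e) = y + (b * s) • e by
    rw [eq_sub_of_add_eq hab]; module, add_smul_mem_strictEpigraph_iff he]
  linarith [mul_nonneg hb hs]

theorem segment_add_smul_subset_strictEpigraph (he : ‖e‖ = 1) (hγ : LipschitzWith K γ) {y z : F}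
    {s : ℝ} (hy : y ∈ strictEpigraph e γ) (hs : (K + 1) * ‖z - y‖ ≤ s) :
    segment ℝ (y + s • e) (z + s • e) ⊆ strictEpigraph e γ := by
  rintro _ ⟨a, b, ha, hb, hab, rfl⟩
  rw [show a • (y + s • e) + b • (z + s • e) = (y + b • (z - y)) + s • e by
    rw [eq_sub_of_add_eq hab]; module]
  refine add_smul_mem_strictEpigraph he hγ hy (le_trans ?_ hs)
  rw [add_sub_cancel_left, norm_smul, Real.norm_of_nonneg hb]
  gcongr
  exact mul_le_of_le_one_left (norm_nonneg _) (by linarith)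

end Lipschitz

theorem isOpen_strictEpigraph (hγ : Continuous γ) : IsOpen (strictEpigraph e γ) :=
  isOpen_lt (by fun_prop) (by fun_prop)

theorem frontier_strictEpigraph (he : ‖e‖ = 1) (hγ : Continuous γ) :
    frontier (strictEpigraph e γ) = {y | γ (y - inner ℝ e y • e) = inner ℝ e y} := by
  refine (frontier_lt_subset_eq (by fun_prop) (by fun_prop)).antisymm
    fun y (hy : γ (y - inner ℝ e y • e) = inner ℝ e y) => ?_
  have hup : Tendsto (fun t : ℝ => y + t • e) (𝓝[>] 0) (𝓝 y) := by
    have : Continuous fun t : ℝ => y + t • e := by fun_prop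
    simpa using (this.tendsto 0).mono_left nhdsWithin_le_nhds
  change y ∈ frontier (strictEpigraph e γ)
  rw [(isOpen_strictEpigraph hγ).frontier_eq]
  refine ⟨mem_closure_of_tendsto hup ?_, hy.not_lt⟩
  filter_upwards [self_mem_nhdsWithin] with t (ht : 0 < t)
  rw [add_smul_mem_strictEpigraph_iff he, hy]
  linarith

end Epigraph

section Frontier

open Module

variable {F : Type*} [NormedAddCommGroup F] [InnerProductSpace ℝ F] [FiniteDimensional ℝ F]

theorem finrank_orthogonal_span_singleton_eq_sub_one {e : F} (he : e ≠ 0) :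
    (finrank ℝ (ℝ ∙ e)ᗮ : ℝ) = finrank ℝ F - 1 := by
  have h := (ℝ ∙ e).finrank_add_finrank_orthogonal
  rw [finrank_span_singleton he] at h
  rw [← h]
  push_cast
  ring

variable [MeasurableSpace F] [BorelSpace F]

theorem hausdorffMeasure_finrank_pos_of_interior_orthogonalProjectionOnto_image_nonempty
    (P : Submodule ℝ F) {S : Set F}
    (hS : (interior (P.orthogonalProjectionOnto '' S)).Nonempty) :
    0 < Measure.hausdorffMeasure (finrank ℝ P) S :=
  calc
    0 < Measure.hausdorffMeasure (finrank ℝ P) (P.orthogonalProjectionOnto '' S) :=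
      Measure.measure_pos_of_nonempty_interior _ hS
    _ ≤ (1 : ℝ≥0) ^ (finrank ℝ P : ℝ) * Measure.hausdorffMeasure (finrank ℝ P) S :=
      P.lipschitzWith_orthogonalProjectionOnto.hausdorffMeasure_image_le (by positivity) S
    _ = Measure.hausdorffMeasure (finrank ℝ P) S := by simp

theorem hausdorffMeasure_frontier_inter_ball_pos {Ω : Set F} {x₀ e : F} {γ : F → ℝ} {r ρ : ℝ}
    (he : ‖e‖ = 1) (hγ : Continuous γ) (hr : 0 < r)
    (hΩ : Ω ∩ Metric.ball x₀ r = strictEpigraph e γ ∩ Metric.ball x₀ r)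
    (hx₀ : x₀ ∈ frontier Ω) (hρ : 0 < ρ) :
    0 < Measure.hausdorffMeasure (finrank ℝ F - 1) (frontier Ω ∩ Metric.ball x₀ ρ) := by
  have hfrontier (y : F) (hy : y ∈ Metric.ball x₀ r) :
      y ∈ frontier Ω ↔ γ (y - inner ℝ e y • e) = inner ℝ e y := by
    have := frontier_inter_open_inter (s := Ω) (Metric.isOpen_ball (x := x₀) (ε := r))
    rw [hΩ, frontier_inter_open_inter Metric.isOpen_ball, frontier_strictEpigraph he hγ] at this
    simpa [hy] using (Set.ext_iff.1 this y).symm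
  let lift (q : (ℝ ∙ e)ᗮ) : F := (q : F) + γ q • e
  have hlift : Continuous lift := by fun_prop
  have hperp (q : (ℝ ∙ e)ᗮ) : inner ℝ e (q : F) = 0 :=
    Submodule.mem_orthogonal_singleton_iff_inner_right.1 q.2
  have hproj (q : (ℝ ∙ e)ᗮ) : lift q - inner ℝ e (lift q) • e = q := by
    rw [add_smul_sub_inner_smul he, hperp]
    simp
  have hinner (q : (ℝ ∙ e)ᗮ) : inner ℝ e (lift q) = γ q := by
    simp [lift, inner_add_right, inner_smul_right, hperp, he]
  have hx₀_lift : lift ((ℝ ∙ e)ᗮ.orthogonalProjectionOnto x₀) = x₀ := by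
    simp only [lift, coe_orthogonalProjectionOnto_orthogonal_span_singleton he,
      (hfrontier x₀ (Metric.mem_ball_self hr)).1 hx₀, sub_add_cancel]
  rw [← finrank_orthogonal_span_singleton_eq_sub_one (e := e) (by rintro rfl; simp at he)]
  refine hausdorffMeasure_finrank_pos_of_interior_orthogonalProjectionOnto_image_nonempty _ ?_
  refine ⟨(ℝ ∙ e)ᗮ.orthogonalProjectionOnto x₀, mem_interior.2
    ⟨lift ⁻¹' Metric.ball x₀ (min r ρ), fun q hq => ?_, Metric.isOpen_ball.preimage hlift, ?_⟩⟩
  · have hq' : lift q ∈ Metric.ball x₀ r ∧ lift q ∈ Metric.ball x₀ ρ := by simpa using hq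
    refine ⟨lift q, ⟨(hfrontier _ hq'.1).2 ?_, hq'.2⟩, Subtype.ext ?_⟩
    · rw [hproj, hinner]
    · rw [coe_orthogonalProjectionOnto_orthogonal_span_singleton he, hproj]
  · simp [hx₀_lift, hr, hρ]

end Frontier

/-! ### Functions that are Lipschitz along segments -/

section SegmentLipschitz

variable {F Y : Type*} [PseudoMetricSpace Y]

/-- `U` is Lipschitz with constant `L` along each segment contained in `Ω`, that is, with respect
to the length of polygonal paths in `Ω`. This is what a bound on the gradient of `U` gives when `Ω`
is not convex. -/
def SegmentLipschitz [SeminormedAddCommGroup F] [NormedSpace ℝ F] (Ω : Set F) (L : ℝ≥0)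
    (U : F → Y) : Prop :=
  ∀ ⦃x y⦄, segment ℝ x y ⊆ Ω → dist (U x) (U y) ≤ L * dist x y

theorem SegmentLipschitz.continuousOn [SeminormedAddCommGroup F] [NormedSpace ℝ F] {Ω : Set F}
    {L : ℝ≥0} {U : F → Y} (hU : SegmentLipschitz Ω L U) (hΩ : IsOpen Ω) : ContinuousOn U Ω := by
  intro x hx
  obtain ⟨r, hr, hrΩ⟩ := Metric.isOpen_iff.1 hΩ x hx
  have hlip : LipschitzOnWith L U (Metric.ball x r) := LipschitzOnWith.of_dist_le_mul
    fun y hy z hz => hU (((convex_ball x r).segment_subset hy hz).trans hrΩ)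
  exact (hlip.continuousOn.continuousAt (Metric.ball_mem_nhds x hr)).continuousWithinAt

-- Near the boundary, `y` and `z` are joined in `Ω` by going up by `s`, across, and down by `s`.
theorem SegmentLipschitz.lipschitzOnWith_inter_ball [NormedAddCommGroup F] [InnerProductSpace ℝ F]
    {Ω : Set F} {L K : ℝ≥0} {U : F → Y} (hU : SegmentLipschitz Ω L U) {x₀ e : F} {γ : F → ℝ} {r : ℝ}
    (he : ‖e‖ = 1) (hγ : LipschitzWith K γ)
    (hΩ : Ω ∩ Metric.ball x₀ r = strictEpigraph e γ ∩ Metric.ball x₀ r) :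
    LipschitzOnWith (L * (2 * K + 3)) U (Ω ∩ Metric.ball x₀ (r / (2 * K + 3))) := by
  refine LipschitzOnWith.of_dist_le_mul fun y hy z hz => ?_
  have hr : (2 * K + 3) * (r / (2 * K + 3)) = r := mul_div_cancel₀ r (by positivity)
  have hyr := Metric.mem_ball.1 hy.2
  have hzr := Metric.mem_ball.1 hz.2
  have hyz := dist_triangle_right y z x₀
  have hρr : r / (2 * K + 3) ≤ r := by nlinarith [K.2, dist_nonneg (x := y) (y := x₀)]
  have hmem (q) (hq : q ∈ Ω ∩ Metric.ball x₀ (r / (2 * K + 3))) : q ∈ strictEpigraph e γ :=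
    (hΩ.subset ⟨hq.1, Metric.ball_subset_ball hρr hq.2⟩).1
  set s : ℝ := (K + 1) * dist y z
  have hs : 0 ≤ s := by positivity
  have hup (q) : dist q (q + s • e) = s := by simp [norm_smul, he, abs_of_nonneg hs]
  have hball (q) (hq : q ∈ Ω ∩ Metric.ball x₀ (r / (2 * K + 3))) :
      q + s • e ∈ Metric.ball x₀ r := by
    have hqr := Metric.mem_ball.1 hq.2
    rw [Metric.mem_ball]
    have := dist_triangle_left (q + s • e) x₀ q
    nlinarith [hup q, K.2]
  have hsegment {p q} (hp : p ∈ Metric.ball x₀ r) (hq : q ∈ Metric.ball x₀ r)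
      (h : segment ℝ p q ⊆ strictEpigraph e γ) : dist (U p) (U q) ≤ L * dist p q :=
    hU ((subset_inter h ((convex_ball x₀ r).segment_subset hp hq)).trans
      (hΩ.symm.subset.trans inter_subset_left))
  have hvertical (q) (hq : q ∈ Ω ∩ Metric.ball x₀ (r / (2 * K + 3))) :
      dist (U q) (U (q + s • e)) ≤ L * s := by
    simpa only [hup] using hsegment (Metric.ball_subset_ball hρr hq.2) (hball q hq)
      (segment_self_add_smul_subset_strictEpigraph he (hmem q hq) hs)
  have hhorizontal : dist (U (y + s • e)) (U (z + s • e)) ≤ L * dist y z := by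
    simpa only [dist_add_right] using hsegment (hball y hy) (hball z hz)
      (segment_add_smul_subset_strictEpigraph he hγ (hmem y hy) (by rw [← dist_eq_norm']))
  calc
    dist (U y) (U z) ≤ dist (U y) (U (y + s • e)) + dist (U (y + s • e)) (U (z + s • e)) +
        dist (U (z + s • e)) (U z) := dist_triangle4 ..
    _ ≤ L * s + L * dist y z + L * s := by
      rw [dist_comm _ (U z)]
      exact add_le_add_three (hvertical y hy) hhorizontal (hvertical z hz)
    _ = (L * (2 * K + 3) : ℝ≥0) * dist y z := by push_cast; ring

end SegmentLipschitz

/-! ### Classical derivatives -/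

section ClassicalDerivatives

open Laplacian

theorem contDiff_partialDeriv {φ : E d → ℝ} (hφ : ContDiff ℝ ∞ φ) (i : Fin d) :
    ContDiff ℝ ∞ (partialDeriv i φ) :=
  (hφ.fderiv_right (by simp)).clm_apply contDiff_const

theorem partialDeriv_const_mul_comp_sub {ψ : E d → ℝ} (hψ : Differentiable ℝ ψ) (i : Fin d) (c : ℝ)
    (x : E d) :
    partialDeriv i (fun y => c * ψ (x - y)) = fun y => -c * partialDeriv i ψ (x - y) := by
  ext y
  have h := (((hψ (x - y)).hasFDerivAt.comp y ((hasFDerivAt_id y).const_sub x)).const_mul c).fderiv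
  simp only [Function.comp_def] at h
  simp [partialDeriv, h]

theorem multiDeriv_induction₂ {R : ℕ → (E d → ℝ) → (E d → ℝ) → Prop} {φ φ' : E d → ℝ}
    (hzero : R 0 φ φ')
    (hsucc : ∀ i k χ χ', R k χ χ' → R (k + 1) (partialDeriv i χ) (partialDeriv i χ'))
    (α : Fin d → ℕ) : R (∑ i, α i) (multiDeriv α φ) (multiDeriv α φ') := by
  have hiterate (i : Fin d) (k n : ℕ) (χ χ' : E d → ℝ) (h : R k χ χ') :
      R (n + k) ((partialDeriv i)^[n] χ) ((partialDeriv i)^[n] χ') := by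
    induction n with
    | zero => simpa using h
    | succ n ih =>
      simp only [Function.iterate_succ_apply', Nat.succ_add]
      exact hsucc _ _ _ _ ih
  rw [Fin.sum_univ_def]
  unfold multiDeriv
  induction List.finRange d with
  | nil => exact hzero
  | cons i l ih => exact hiterate i _ (α i) _ _ ih

theorem multiDeriv_comp_sub {ψ : E d → ℝ} (hψ : ContDiff ℝ ∞ ψ) (α : Fin d → ℕ) (x : E d) :
    multiDeriv α (fun y => ψ (x - y)) =
      fun y => (-1) ^ (∑ i, α i) * multiDeriv α ψ (x - y) := by
  refine (multiDeriv_induction₂ (R := fun k χ χ' => ContDiff ℝ ∞ χ ∧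
    χ' = fun y => (-1) ^ k * χ (x - y)) ⟨hψ, by simp⟩ ?_ α).2
  rintro i k χ _ ⟨hχ, rfl⟩
  refine ⟨contDiff_partialDeriv hχ i, ?_⟩
  rw [partialDeriv_const_mul_comp_sub (hχ.differentiable (by simp)), pow_succ, mul_neg_one]

theorem multiDeriv_single (i : Fin d) (k : ℕ) (φ : E d → ℝ) :
    multiDeriv (Pi.single i k) φ = (partialDeriv i)^[k] φ := by
  have hfoldr (l : List (Fin d)) (hl : l.Nodup) :
      l.foldr (fun j ψ => (partialDeriv j)^[(Pi.single i k : Fin d → ℕ) j] ψ) φ =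
        if i ∈ l then (partialDeriv i)^[k] φ else φ := by
    induction l with
    | nil => simp
    | cons j l ih =>
      rw [List.nodup_cons] at hl
      rw [List.foldr_cons, ih hl.2]
      rcases eq_or_ne j i with rfl | hji
      · simp [hl.1]
      · simp [hji, hji.symm]
  rw [multiDeriv, hfoldr _ (List.nodup_finRange d), if_pos (List.mem_finRange i)]

theorem laplacian_eq_sum_multiDeriv {W : E d → ℝ} (hW : ContDiff ℝ 2 W) (x : E d) :
    Δ W x = ∑ i, multiDeriv (Pi.single i 2) W x := by
  rw [InnerProductSpace.laplacian_eq_iteratedFDeriv_orthonormalBasis W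
    (EuclideanSpace.basisFun (Fin d) ℝ)]
  refine Finset.sum_congr rfl fun i _ => ?_
  have hdiff : DifferentiableAt ℝ (fderiv ℝ W) x :=
    (hW.fderiv_right (m := 1) (by norm_num)).differentiable one_ne_zero x
  rw [multiDeriv_single, Function.iterate_succ_apply, Function.iterate_one,
    iteratedFDeriv_two_apply]
  unfold partialDeriv
  rw [fderiv_clm_apply hdiff (differentiableAt_const _)]
  simp

theorem norm_fderiv_le_sum {W : E d → ℝ} {x : E d} {B : Fin d → ℝ}
    (hB : ∀ i, |partialDeriv i W x| ≤ B i) : ‖fderiv ℝ W x‖ ≤ ∑ i, B i := by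
  have hB₀ (i : Fin d) : 0 ≤ B i := (abs_nonneg _).trans (hB i)
  refine ContinuousLinearMap.opNorm_le_bound _ (Finset.sum_nonneg fun i _ => hB₀ i) fun v => ?_
  have hv : fderiv ℝ W x v = ∑ i, v i * partialDeriv i W x := by
    conv_lhs => rw [← (EuclideanSpace.basisFun (Fin d) ℝ).sum_repr v]
    simp [partialDeriv]
  rw [hv, Finset.sum_mul]
  refine (norm_sum_le _ _).trans (Finset.sum_le_sum fun i _ => ?_)
  rw [norm_mul, mul_comm]
  exact mul_le_mul (hB i) (PiLp.norm_apply_le v i) (norm_nonneg _) (hB₀ i)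

end ClassicalDerivatives

/-! ### Mollification -/

section Mollification

open Laplacian

variable {Ω : Set (E d)} {u v ψ : E d → ℝ} {x : E d}

/-- The mollification by the kernel `ψ` of a function `u` on `Ω`, extended by zero outside `Ω`. -/
def mollify (Ω : Set (E d)) (ψ u : E d → ℝ) : E d → ℝ :=
  convolution ψ (Ω.indicator u) (ContinuousLinearMap.lsmul ℝ ℝ) volume

theorem mollify_apply (hΩ : MeasurableSet Ω) (ψ u : E d → ℝ) (x : E d) :
    mollify Ω ψ u x = ∫ y in Ω, u y * ψ (x - y) := by
  rw [mollify, convolution_lsmul_swap, ← integral_indicator hΩ]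
  congr 1 with y
  by_cases hy : y ∈ Ω <;> simp [hy, mul_comm]

section Smooth

variable (hΩ : MeasurableSet Ω) (hu : IntegrableOn u Ω) (hψ : ContDiff ℝ ∞ ψ)
  (hψc : HasCompactSupport ψ)

include hΩ hu hψ hψc

theorem contDiff_mollify : ContDiff ℝ ∞ (mollify Ω ψ u) :=
  hψc.contDiff_convolution_left _ hψ ((integrable_indicator_iff hΩ).2 hu).locallyIntegrable

theorem partialDeriv_mollify (i : Fin d) :
    partialDeriv i (mollify Ω ψ u) = mollify Ω (partialDeriv i ψ) u := by
  ext x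
  have hint := ((integrable_indicator_iff hΩ).2 hu).locallyIntegrable
  have hψ₁ : ContDiff ℝ 1 ψ := hψ.of_le (by simp)
  rw [partialDeriv, mollify, (hψc.hasFDerivAt_convolution_left _ hψ₁ hint x).fderiv,
    convolution_def, ContinuousLinearMap.integral_apply]
  · rfl
  · exact (hψc.fderiv ℝ).convolutionExists_left _ (hψ₁.continuous_fderiv (by simp)) hint x

theorem multiDeriv_mollify (α : Fin d → ℕ) :
    multiDeriv α (mollify Ω ψ u) = mollify Ω (multiDeriv α ψ) u := by
  refine (multiDeriv_induction₂ (R := fun _ χ χ' => ContDiff ℝ ∞ χ ∧ HasCompactSupport χ ∧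
    χ' = mollify Ω χ u) ⟨hψ, hψc, rfl⟩ ?_ α).2.2
  rintro i _ χ _ ⟨hχ, hχc, rfl⟩
  exact ⟨contDiff_partialDeriv hχ i, hχc.fderiv_apply ℝ _, partialDeriv_mollify hΩ hu hχ hχc i⟩

end Smooth

section Support

variable {ε : ℝ} (hψs : tsupport ψ ⊆ Metric.closedBall 0 ε)

include hψs

theorem support_comp_sub_subset_closedBall (x : E d) :
    Function.support (fun y => ψ (x - y)) ⊆ Metric.closedBall x ε := fun y hy => by
  have := hψs (subset_tsupport ψ hy)
  rwa [mem_closedBall_zero_iff, ← dist_eq_norm, dist_comm] at this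

theorem isTestFunction_comp_sub (hψ : ContDiff ℝ ∞ ψ) (hx : Metric.closedBall x ε ⊆ Ω) :
    IsTestFunction Ω fun y => ψ (x - y) := by
  have hsub : tsupport (fun y => ψ (x - y)) ⊆ Metric.closedBall x ε :=
    closure_minimal (support_comp_sub_subset_closedBall hψs x) Metric.isClosed_closedBall
  exact ⟨hψ.comp (contDiff_const.sub contDiff_id),
    (isCompact_closedBall x ε).of_isClosed_subset (isClosed_tsupport _) hsub, hsub.trans hx⟩

theorem integrableOn_mul_comp_sub (hv : LocallyIntegrableOn v Ω) (hψ : Continuous ψ)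
    (hx : Metric.closedBall x ε ⊆ Ω) : IntegrableOn (fun y => v y * ψ (x - y)) Ω := by
  have hball : IntegrableOn (fun y => v y * ψ (x - y)) (Metric.closedBall x ε) :=
    (hv.integrableOn_compact_subset hx (isCompact_closedBall x ε)).mul_continuousOn (by fun_prop)
      (isCompact_closedBall x ε)
  refine Integrable.integrableOn ((integrableOn_iff_integrable_of_support_subset ?_).1 hball)
  exact (Function.support_mul_subset_right _ _).trans (support_comp_sub_subset_closedBall hψs x)

theorem HasWeakDeriv.multiDeriv_mollify {α : Fin d → ℕ} (h : HasWeakDeriv Ω α u v)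
    (hΩ : MeasurableSet Ω) (hu : IntegrableOn u Ω) (hψ : ContDiff ℝ ∞ ψ)
    (hx : Metric.closedBall x ε ⊆ Ω) :
    multiDeriv α (mollify Ω ψ u) x = mollify Ω ψ v x := by
  have hψc : HasCompactSupport ψ :=
    (isCompact_closedBall (0 : E d) ε).of_isClosed_subset (isClosed_tsupport ψ) hψs
  have hparts := h.integral_eq _ (isTestFunction_comp_sub hψs hψ hx)
  rw [multiDeriv_comp_sub hψ] at hparts
  simp only [mul_left_comm (u _), integral_const_mul] at hparts
  rw [PoissonEstimate.multiDeriv_mollify hΩ hu hψ hψc, mollify_apply hΩ, mollify_apply hΩ]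
  exact mul_left_cancel₀ (pow_ne_zero _ (neg_ne_zero.2 one_ne_zero)) hparts

theorem laplacian_mollify {v : Fin d → E d → ℝ}
    (hv : ∀ i, HasWeakDeriv Ω (Pi.single i 2) u (v i)) (hΩ : MeasurableSet Ω)
    (hu : IntegrableOn u Ω) (hψ : ContDiff ℝ ∞ ψ) (hx : Metric.closedBall x ε ⊆ Ω) :
    Δ (mollify Ω ψ u) x = mollify Ω ψ (fun y => ∑ i, v i y) x := by
  have hψc : HasCompactSupport ψ :=
    (isCompact_closedBall (0 : E d) ε).of_isClosed_subset (isClosed_tsupport ψ) hψs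
  have hsmooth : ContDiff ℝ 2 (mollify Ω ψ u) :=
    contDiff_infty.1 (contDiff_mollify hΩ hu hψ hψc) 2
  rw [laplacian_eq_sum_multiDeriv hsmooth, mollify_apply hΩ]
  simp only [Finset.sum_mul]
  rw [integral_finsetSum _ fun i _ => integrableOn_mul_comp_sub hψs (hv i).right hψ.continuous hx]
  refine Finset.sum_congr rfl fun i _ => ?_
  rw [(hv i).multiDeriv_mollify hψs hΩ hu hψ hx, mollify_apply hΩ]

end Support

section Bump

variable (φ : ContDiffBump (0 : E d))

theorem abs_mollify_normed_le (hΩ : MeasurableSet Ω) {B : ℝ} (hB : 0 ≤ B)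
    (hv : ∀ᵐ y ∂volume.restrict Ω, |v y| ≤ B) (x : E d) :
    |mollify Ω (φ.normed volume) v x| ≤ B := by
  have hint : Integrable fun y => B * φ.normed volume (x - y) :=
    (φ.integrable_normed.comp_sub_left x).const_mul B
  rw [mollify_apply hΩ, ← Real.norm_eq_abs]
  calc ‖∫ y in Ω, v y * φ.normed volume (x - y)‖
      ≤ ∫ y in Ω, B * φ.normed volume (x - y) := by
        refine norm_integral_le_of_norm_le hint.integrableOn ?_
        filter_upwards [hv] with y hy
        rw [norm_mul, Real.norm_eq_abs, Real.norm_of_nonneg (φ.nonneg_normed _)]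
        exact mul_le_mul_of_nonneg_right hy (φ.nonneg_normed _)
    _ ≤ ∫ y, B * φ.normed volume (x - y) :=
        setIntegral_le_integral hint (.of_forall fun y => mul_nonneg hB (φ.nonneg_normed _))
    _ = B := by
        rw [integral_const_mul, integral_sub_left_eq_self (φ.normed volume) volume x,
          φ.integral_normed, mul_one]

theorem le_mollify_normed (hΩ : MeasurableSet Ω) (hv : LocallyIntegrableOn v Ω) {c : ℝ}
    (hc : ∀ᵐ y ∂volume.restrict Ω, c ≤ v y) (hx : Metric.closedBall x φ.rOut ⊆ Ω) :
    c ≤ mollify Ω (φ.normed volume) v x := by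
  have hφ : tsupport (φ.normed volume) ⊆ Metric.closedBall 0 φ.rOut :=
    φ.tsupport_normed_eq.subset
  have hint : Integrable fun y => c * φ.normed volume (x - y) :=
    (φ.integrable_normed.comp_sub_left x).const_mul c
  rw [mollify_apply hΩ]
  calc
    c = ∫ y, c * φ.normed volume (x - y) := by
      rw [integral_const_mul, integral_sub_left_eq_self (φ.normed volume) volume x,
        φ.integral_normed, mul_one]
    _ = ∫ y in Ω, c * φ.normed volume (x - y) := by
      refine (setIntegral_eq_integral_of_forall_compl_eq_zero fun y hy => ?_).symm
      rw [Function.notMem_support.1 fun h => hy (hx (support_comp_sub_subset_closedBall hφ x h)),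
        mul_zero]
    _ ≤ ∫ y in Ω, v y * φ.normed volume (x - y) := by
      refine integral_mono_ae hint.integrableOn
        (integrableOn_mul_comp_sub hφ hv φ.continuous_normed hx) ?_
      filter_upwards [hc] with y hy
      exact mul_le_mul_of_nonneg_right hy (φ.nonneg_normed _)

end Bump

theorem exists_forall_abs_mollify_sub_le (hΩ : IsOpen Ω) {V : E d → ℝ} (hV : ContinuousOn V Ω)
    {K : Set (E d)} (hK : IsCompact K) (hKΩ : K ⊆ Ω) {η : ℝ} (hη : 0 < η) :
    ∃ φ : ContDiffBump (0 : E d), ∀ y ∈ K, Metric.closedBall y φ.rOut ⊆ Ω ∧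
      |mollify Ω (φ.normed volume) V y - V y| ≤ η := by
  obtain ⟨δ, hδ, hδΩ⟩ := hK.exists_cthickening_subset_open hΩ hKΩ
  obtain ⟨ε, hε, hVε⟩ := Metric.uniformContinuousOn_iff.1
    (hK.cthickening.uniformContinuousOn_of_continuous (hV.mono hδΩ)) η hη
  have hr : 0 < min δ ε := lt_min hδ hε
  let φ : ContDiffBump (0 : E d) := ⟨min δ ε / 2, min δ ε, half_pos hr, half_lt_self hr⟩
  have hmeas : AEStronglyMeasurable (Ω.indicator V) volume :=
    (aestronglyMeasurable_indicator_iff hΩ.measurableSet).2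
      (hV.aestronglyMeasurable hΩ.measurableSet)
  refine ⟨φ, fun y hy => ?_⟩
  have hball : Metric.closedBall y φ.rOut ⊆ Metric.cthickening δ K :=
    (Metric.closedBall_subset_closedBall (min_le_left _ _)).trans
      (Metric.closedBall_subset_cthickening hy δ)
  refine ⟨hball.trans hδΩ, ?_⟩
  have hdist := φ.dist_normed_convolution_le (x₀ := y) (ε := η) hmeas fun z hz => by
    have hzK := hball (Metric.ball_subset_closedBall hz)
    rw [indicator_of_mem (hδΩ hzK), indicator_of_mem (hKΩ hy)]
    exact (hVε z hzK y (Metric.self_subset_cthickening K hy)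
      (hz.trans_le (min_le_right _ _))).le
  rwa [indicator_of_mem (hKΩ hy), Real.dist_eq] at hdist

theorem HasWeakDeriv.neg {α : Fin d → ℕ} (h : HasWeakDeriv Ω α u v) :
    HasWeakDeriv Ω α (-u) (-v) where
  left := h.left.neg
  right := h.right.neg
  integral_eq φ hφ := by
    simp only [Pi.neg_apply, neg_mul, integral_neg, h.integral_eq φ hφ, mul_neg]

theorem le_add_mul_diam_sq_of_hasWeakDeriv [NeZero d] (hΩ : IsOpen Ω)
    (hb : Bornology.IsBounded Ω) {V : E d → ℝ} (hV : ContinuousOn V Ω) (hVint : IntegrableOn V Ω)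
    {v : Fin d → E d → ℝ} (hv : ∀ i, HasWeakDeriv Ω (Pi.single i 2) V (v i)) {C G : ℝ}
    (hC : 0 ≤ C) (hΔ : ∀ᵐ y ∂volume.restrict Ω, -C ≤ ∑ i, v i y)
    (hbd : ∀ x ∈ frontier Ω, ∀ c > G, ∀ᶠ y in 𝓝[Ω] x, V y < c) (hx : x ∈ Ω) :
    V x ≤ G + C / (2 * d) * Metric.diam Ω ^ 2 := by
  have hsum : LocallyIntegrableOn (fun y => ∑ i, v i y) Ω :=
    (locallyIntegrableOn_iff hΩ.isLocallyClosed).2 fun K hKΩ hK =>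
      integrable_finsetSum _ fun i _ => (hv i).right.integrableOn_compact_subset hKΩ hK
  suffices V x ≤ G + C / (2 * Module.finrank ℝ (E d)) * Metric.diam Ω ^ 2 by
    simpa only [finrank_euclideanSpace_fin] using this
  refine le_add_mul_diam_sq_of_smooth_approx hΩ hb hV hC (fun K hKΩ hK η hη => ?_) hbd hx
  obtain ⟨φ, hφ⟩ := exists_forall_abs_mollify_sub_le hΩ hV hK hKΩ hη
  refine ⟨mollify Ω (φ.normed volume) V, contDiff_infty.1 (contDiff_mollify hΩ.measurableSet hVint
    φ.contDiff_normed φ.hasCompactSupport_normed) 2, fun y hy => ⟨(hφ y hy).2, ?_⟩⟩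
  rw [laplacian_mollify φ.tsupport_normed_eq.subset hv hΩ.measurableSet hVint φ.contDiff_normed
    (hφ y hy).1]
  exact le_mollify_normed φ hΩ.measurableSet hsum hΔ (hφ y hy).1

theorem abs_le_add_mul_diam_sq_of_hasWeakDeriv [NeZero d] (hΩ : IsOpen Ω)
    (hb : Bornology.IsBounded Ω) {V : E d → ℝ} (hV : ContinuousOn V Ω) (hVint : IntegrableOn V Ω)
    {v : Fin d → E d → ℝ} (hv : ∀ i, HasWeakDeriv Ω (Pi.single i 2) V (v i)) {C G : ℝ}
    (hC : 0 ≤ C) (hΔ : ∀ᵐ y ∂volume.restrict Ω, |∑ i, v i y| ≤ C)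
    (hbd : ∀ x ∈ frontier Ω, ∀ c > G, ∀ᶠ y in 𝓝[Ω] x, |V y| < c) (hx : x ∈ Ω) :
    |V x| ≤ G + C / (2 * d) * Metric.diam Ω ^ 2 := by
  rw [abs_le']
  constructor
  · exact le_add_mul_diam_sq_of_hasWeakDeriv hΩ hb hV hVint hv hC
      (hΔ.mono fun y hy => (abs_le.1 hy).1)
      (fun x hx c hc => (hbd x hx c hc).mono fun y hy => (abs_lt.1 hy).2) hx
  · refine le_add_mul_diam_sq_of_hasWeakDeriv (V := -V) hΩ hb hV.neg hVint.neg
      (fun i => (hv i).neg) hC (hΔ.mono fun y hy => ?_)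
      (fun x hx c hc => (hbd x hx c hc).mono fun y hy => neg_lt.1 (abs_lt.1 hy).1) hx
    simpa using (abs_le.1 hy).2

end Mollification

/-! ### The Lipschitz representative -/

section LipschitzRepresentative

variable {Ω : Set (E d)} {u : E d → ℝ}

theorem ae_norm_le_toReal_of_eLpNorm_top_le {α Y : Type*} [MeasurableSpace α] {μ : Measure α}
    [NormedAddCommGroup Y] {f : α → Y} {N : ℝ≥0∞} (hN : N ≠ ⊤) (hf : eLpNorm f ∞ μ ≤ N) :
    ∀ᵐ y ∂μ, ‖f y‖ ≤ N.toReal := by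
  rw [eLpNorm_exponent_top] at hf
  filter_upwards [ae_le_eLpNormEssSup (f := f) (μ := μ)] with y hy
  rw [← toReal_enorm]
  exact ENNReal.toReal_mono hN (hy.trans hf)

theorem integrableOn_of_memLp_top (hb : Bornology.IsBounded Ω)
    (hu : MemLp u ∞ (volume.restrict Ω)) : IntegrableOn u Ω := by
  have : IsFiniteMeasure (volume.restrict Ω) := ⟨by simpa using hb.measure_lt_top⟩
  exact hu.integrable le_top

theorem abs_mollify_sub_le_of_segment (hΩ : MeasurableSet Ω) (hu : IntegrableOn u Ω)
    {v : Fin d → E d → ℝ} (hv : ∀ i, HasWeakDeriv Ω (Pi.single i 1) u (v i)) {B : Fin d → ℝ}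
    (hB : ∀ i, 0 ≤ B i) (hvB : ∀ i, ∀ᵐ y ∂volume.restrict Ω, |v i y| ≤ B i)
    (φ : ContDiffBump (0 : E d)) {x y : E d}
    (hxy : ∀ z ∈ segment ℝ x y, Metric.closedBall z φ.rOut ⊆ Ω) :
    |mollify Ω (φ.normed volume) u x - mollify Ω (φ.normed volume) u y| ≤
      (∑ i, B i) * ‖x - y‖ := by
  have hsmooth : ContDiff ℝ ∞ (mollify Ω (φ.normed volume) u) :=
    contDiff_mollify hΩ hu φ.contDiff_normed φ.hasCompactSupport_normed
  refine (convex_segment x y).norm_image_sub_le_of_norm_fderiv_le (𝕜 := ℝ)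
    (fun z _ => (hsmooth.differentiable (by simp)).differentiableAt)
    (fun z hz => norm_fderiv_le_sum fun i => ?_) (right_mem_segment ℝ x y)
    (left_mem_segment ℝ x y)
  rw [← Function.iterate_one (partialDeriv i), ← multiDeriv_single,
    (hv i).multiDeriv_mollify φ.tsupport_normed_eq.subset hΩ hu φ.contDiff_normed (hxy z hz)]
  exact abs_mollify_normed_le φ hΩ (hB i) (hvB i) z

-- An ultrafilter limit of the mollifications exists at every point, not just almost everywhere.
theorem MemSobolev.exists_segmentLipschitz (hΩ : IsOpen Ω) (hb : Bornology.IsBounded Ω)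
    (hu : MemSobolev Ω 1 ∞ u) :
    ∃ (U : E d → ℝ) (L : ℝ≥0), U =ᵐ[volume.restrict Ω] u ∧ SegmentLipschitz Ω L U := by
  have hΩm := hΩ.measurableSet
  have hint := integrableOn_of_memLp_top hb hu.memLp
  choose v hv hvLp using fun i : Fin d => hu.deriv (Pi.single i 1) (by simp)
  have huM := ae_norm_le_toReal_of_eLpNorm_top_le hu.memLp.2.ne le_rfl
  have hvB (i : Fin d) := ae_norm_le_toReal_of_eLpNorm_top_le (hvLp i).2.ne le_rfl
  let φ (n : ℕ) : ContDiffBump (0 : E d) :=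
    ⟨1 / ((n : ℝ) + 1) / 2, 1 / ((n : ℝ) + 1), by positivity, half_lt_self (by positivity)⟩
  have hrOut : Tendsto (fun n => (φ n).rOut) (hyperfilter ℕ) (𝓝 0) :=
    tendsto_one_div_add_atTop_nhds_zero_nat.mono_left Nat.hyperfilter_le_atTop
  have hlim (x : E d) :
      ∃ a, Tendsto (fun n => mollify Ω ((φ n).normed volume) u x) (hyperfilter ℕ) (𝓝 a) := by
    obtain ⟨a, -, ha⟩ := isCompact_Icc.ultrafilter_le_nhds'
      ((hyperfilter ℕ).map fun n => mollify Ω ((φ n).normed volume) u x)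
      (Ultrafilter.mem_map.2 (univ_mem' fun n =>
        abs_le.1 (abs_mollify_normed_le (φ n) hΩm ENNReal.toReal_nonneg huM x)))
    exact ⟨a, ha⟩
  choose U hU using hlim
  refine ⟨U, ∑ i, (eLpNorm (v i) ∞ (volume.restrict Ω)).toNNReal, ?_, fun x y hxy => ?_⟩
  · have hae := ContDiffBump.ae_convolution_tendsto_right_of_locallyIntegrable (K := 2) hrOut
      (.of_forall fun n => (mul_div_cancel₀ _ two_ne_zero).ge)
      ((integrable_indicator_iff hΩm).2 hint).locallyIntegrable
    rw [EventuallyEq, ae_restrict_iff' hΩm]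
    filter_upwards [hae] with x hx hxΩ
    rw [indicator_of_mem hxΩ] at hx
    exact tendsto_nhds_unique (hU x) hx
  · have hcompact : IsCompact (segment ℝ x y) := by
      rw [segment_eq_image']
      exact isCompact_Icc.image (by fun_prop)
    obtain ⟨δ, hδ, hδΩ⟩ := hcompact.exists_cthickening_subset_open hΩ hxy
    rw [Real.dist_eq, dist_eq_norm, NNReal.coe_sum]
    refine le_of_tendsto ((hU x).sub (hU y)).abs ?_
    filter_upwards [hrOut.eventually (gt_mem_nhds hδ)] with n hn
    exact abs_mollify_sub_le_of_segment hΩm hint hv (fun i => ENNReal.toReal_nonneg) hvB (φ n)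
      fun z hz => (Metric.closedBall_subset_cthickening hz _).trans
        ((Metric.cthickening_mono hn.le _).trans hδΩ)

end LipschitzRepresentative

/-! ### Boundary values -/

section BoundaryValues

variable {Ω : Set (E d)} {u U g : E d → ℝ} {x₀ : E d}

theorem surfaceMeasure_ball_pos (hlip : HasLipschitzBoundary Ω) (hx₀ : x₀ ∈ frontier Ω) {ρ : ℝ}
    (hρ : 0 < ρ) : 0 < surfaceMeasure Ω (Metric.ball x₀ ρ) := by
  obtain ⟨r, hr, e, he, K, γ, hγ, hΩ⟩ := hlip x₀ hx₀
  have hpos := hausdorffMeasure_frontier_inter_ball_pos he hγ.continuous hr hΩ hx₀ hρ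
  rw [finrank_euclideanSpace_fin, inter_comm] at hpos
  rwa [surfaceMeasure, Measure.restrict_apply measurableSet_ball]

theorem HasTrace.congr (hg : HasTrace Ω u g) (huU : u =ᵐ[volume.restrict Ω] U) :
    HasTrace Ω U g := by
  filter_upwards [hg] with x hx
  refine hx.congr fun r => laverage_congr ?_
  filter_upwards [ae_restrict_of_ae_restrict_of_subset inter_subset_left huU] with y hy
  rw [hy]

theorem exists_abs_sub_le_of_tendsto_laverage (hΩ : IsOpen Ω) (hU : ContinuousOn U Ω) {x : E d}
    (hx : x ∈ closure Ω) {c : ℝ}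
    (h : Tendsto (fun r : ℝ => ⨍⁻ y in Ω ∩ Metric.ball x r, ‖U y - c‖ₑ ∂volume) (𝓝[>] 0) (𝓝 0))
    {ρ η : ℝ} (hρ : 0 < ρ) (hη : 0 < η) : ∃ z ∈ Ω ∩ Metric.ball x ρ, |U z - c| ≤ η := by
  obtain ⟨r, hrη, hr, hrρ⟩ := ((h.eventually (gt_mem_nhds (ENNReal.ofReal_pos.2 hη))).and
    (Ioo_mem_nhdsGT hρ)).exists
  have hopen : IsOpen (Ω ∩ Metric.ball x r) := hΩ.inter Metric.isOpen_ball
  have hne : (Ω ∩ Metric.ball x r).Nonempty :=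
    inter_comm Ω _ ▸ mem_closure_iff_nhds.1 hx _ (Metric.ball_mem_nhds x hr)
  have hmeas : AEMeasurable (fun y => ‖U y - c‖ₑ) (volume.restrict (Ω ∩ Metric.ball x r)) :=
    (((hU.mono inter_subset_left).aestronglyMeasurable hopen.measurableSet).sub
      aestronglyMeasurable_const).enorm
  obtain ⟨z, hz, hzle⟩ := exists_le_setLAverage (hopen.measure_pos volume hne).ne'
    (Metric.isBounded_ball.subset inter_subset_right).measure_lt_top.ne hmeas
  refine ⟨z, ⟨hz.1, Metric.ball_subset_ball hrρ.le hz.2⟩, ?_⟩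
  rw [← Real.norm_eq_abs, ← ENNReal.ofReal_le_ofReal_iff hη.le, ofReal_norm]
  exact hzle.trans hrη.le

theorem exists_uniformContinuousOn_inter_ball (hlip : HasLipschitzBoundary Ω) {L : ℝ≥0}
    (hU : SegmentLipschitz Ω L U) (hx₀ : x₀ ∈ frontier Ω) :
    ∃ ρ > 0, UniformContinuousOn U (Ω ∩ Metric.ball x₀ ρ) := by
  obtain ⟨r, hr, e, he, K, γ, hγ, hΩ⟩ := hlip x₀ hx₀
  exact ⟨r / (2 * K + 3), by positivity,
    (hU.lipschitzOnWith_inter_ball he hγ hΩ).uniformContinuousOn⟩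

theorem eventually_abs_lt_of_hasTrace (hΩ : IsOpen Ω) (hlip : HasLipschitzBoundary Ω) {L : ℝ≥0}
    (hU : SegmentLipschitz Ω L U) (hg : HasTrace Ω U g) {G : ℝ}
    (hG : ∀ᵐ x ∂surfaceMeasure Ω, |g x| ≤ G) (hx₀ : x₀ ∈ frontier Ω) {c : ℝ} (hc : G < c) :
    ∀ᶠ y in 𝓝[Ω] x₀, |U y| < c := by
  have hη : 0 < (c - G) / 2 := by linarith
  obtain ⟨ρ₀, hρ₀, hunif⟩ := exists_uniformContinuousOn_inter_ball hlip hU hx₀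
  obtain ⟨ε, hε, hUε⟩ := Metric.uniformContinuousOn_iff.1 hunif _ hη
  set ρ := min ρ₀ (ε / 2)
  have hρ : 0 < ρ := lt_min hρ₀ (half_pos hε)
  have hsub : Metric.ball x₀ ρ ⊆ Metric.ball x₀ ρ₀ := Metric.ball_subset_ball (min_le_left _ _)
  have hfrontier : ∀ᵐ x ∂surfaceMeasure Ω, x ∈ frontier Ω :=
    ae_restrict_mem isClosed_frontier.measurableSet
  obtain ⟨x, hxρ, hxf, hxg, hxG⟩ := Measure.exists_mem_of_measure_ne_zero_of_ae
    (surfaceMeasure_ball_pos hlip hx₀ hρ).ne' (ae_restrict_of_ae (hfrontier.and (hg.and hG)))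
  obtain ⟨r, hr, hrρ⟩ := Metric.isOpen_iff.1 Metric.isOpen_ball x hxρ
  obtain ⟨z, ⟨hzΩ, hzr⟩, hzg⟩ := exists_abs_sub_le_of_tendsto_laverage hΩ (hU.continuousOn hΩ)
    (frontier_subset_closure hxf) hxg hr hη
  have hzρ := hrρ hzr
  filter_upwards [self_mem_nhdsWithin, nhdsWithin_le_nhds (Metric.ball_mem_nhds x₀ hρ)]
    with y hyΩ hyρ
  have hyz : dist y z < ε := by
    have := dist_triangle_right y z x₀
    have := min_le_right ρ₀ (ε / 2)
    linarith [Metric.mem_ball.1 hyρ, Metric.mem_ball.1 hzρ]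
  have hUyz := hUε y ⟨hyΩ, hsub hyρ⟩ z ⟨hzΩ, hsub hzρ⟩ hyz
  rw [Real.dist_eq] at hUyz
  calc
    |U y| = |(U y - U z) + (U z - g x) + g x| := by ring_nf
    _ ≤ |U y - U z| + |U z - g x| + |g x| := abs_add_three _ _ _
    _ < c := by linarith

end BoundaryValues

/-! ### The estimate -/

section Estimate

variable {Ω : Set (E d)} {u U v : E d → ℝ} {α : Fin d → ℕ}

theorem HasWeakDeriv.congr (h : HasWeakDeriv Ω α u v) (huU : u =ᵐ[volume.restrict Ω] U)
    (hU : LocallyIntegrableOn U Ω) : HasWeakDeriv Ω α U v where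
  left := hU
  right := h.right
  integral_eq φ hφ := by
    rw [← h.integral_eq φ hφ]
    exact integral_congr_ae (huU.mono fun y hy => congrArg (· * multiDeriv α φ y) hy.symm)

theorem hasWeakDeriv_weakDeriv (h : ∃ v, HasWeakDeriv Ω α u v) :
    HasWeakDeriv Ω α u (weakDeriv Ω α u) := by
  rw [weakDeriv, dif_pos h]
  exact h.choose_spec

theorem hasTrace_boundaryTrace (h : ∃ g, HasTrace Ω u g) : HasTrace Ω u (boundaryTrace Ω u) := by
  rw [boundaryTrace, dif_pos h]
  exact h.choose_spec

theorem MemSobolev.mono {k m : ℕ} {p : ℝ≥0∞} (hu : MemSobolev Ω m p u) (hkm : k ≤ m) :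
    MemSobolev Ω k p u :=
  ⟨hu.memLp, fun α hα => hu.deriv α (hα.trans hkm)⟩

theorem MemSobolev.eLpNorm_top_le_mul_dataNorm [NeZero d] (hΩ : IsOpen Ω)
    (hb : Bornology.IsBounded Ω) (hlip : HasLipschitzBoundary Ω) (hu : MemSobolev Ω 1 ∞ u)
    (hweak : ∀ i, ∃ v, HasWeakDeriv Ω (Pi.single i 2) u v) (htrace : ∃ g, HasTrace Ω u g) :
    eLpNorm u ∞ (volume.restrict Ω) ≤
      ENNReal.ofReal (1 + Metric.diam Ω ^ 2 / (2 * d)) * dataNorm Ω u := by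
  have hconst : 0 < 1 + Metric.diam Ω ^ 2 / (2 * d) := by positivity
  rcases eq_or_ne (dataNorm Ω u) ⊤ with hN | hN
  · rw [hN, ENNReal.mul_top (ENNReal.ofReal_pos.2 hconst).ne']
    exact le_top
  obtain ⟨U, L, hUu, hU⟩ := hu.exists_segmentLipschitz hΩ hb
  have hUint : IntegrableOn U Ω := (integrableOn_of_memLp_top hb hu.memLp).congr hUu.symm
  have hweakU (i : Fin d) := (hasWeakDeriv_weakDeriv (hweak i)).congr hUu.symm
    hUint.locallyIntegrableOn
  have htraceU := (hasTrace_boundaryTrace htrace).congr hUu.symm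
  have hΔ := ae_norm_le_toReal_of_eLpNorm_top_le hN (le_max_left _ _)
  have hG := ae_norm_le_toReal_of_eLpNorm_top_le hN (le_max_right _ _)
  rw [eLpNorm_exponent_top, ← ENNReal.ofReal_toReal hN, ← ENNReal.ofReal_mul hconst.le]
  refine eLpNormEssSup_le_of_ae_bound ?_
  filter_upwards [hUu, ae_restrict_mem hΩ.measurableSet] with x hx hxΩ
  calc
    ‖u x‖ = |U x| := by rw [← hx, Real.norm_eq_abs]
    _ ≤ (dataNorm Ω u).toReal + (dataNorm Ω u).toReal / (2 * d) * Metric.diam Ω ^ 2 :=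
      abs_le_add_mul_diam_sq_of_hasWeakDeriv hΩ hb (hU.continuousOn hΩ) hUint hweakU
        ENNReal.toReal_nonneg hΔ
        (fun y hy c hc => eventually_abs_lt_of_hasTrace hΩ hlip hU htraceU hG hy hc) hxΩ
    _ = (1 + Metric.diam Ω ^ 2 / (2 * d)) * (dataNorm Ω u).toReal := by ring

theorem volume_le_volume_closedBall_diam (hb : Bornology.IsBounded Ω) :
    volume Ω ≤ volume (Metric.closedBall (0 : E d) (Metric.diam Ω)) := by
  rcases Ω.eq_empty_or_nonempty with rfl | ⟨x, hx⟩
  · simp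
  · rw [← Measure.addHaar_closedBall_center volume x]
    exact measure_mono fun y hy => Metric.dist_le_diam_of_mem hb hy hx

/-- The constant of the `L_p` estimate on `Ω`: the constant `1 + diam² Ω / (2d)` of the `L_∞`
estimate, times the `L_p` norm of `1` on a ball of radius `diam Ω`. -/
def poissonConstant (p : ℝ≥0∞) (Ω : Set (E d)) : ℝ≥0 :=
  (ENNReal.ofReal (1 + Metric.diam Ω ^ 2 / (2 * d)) *
    volume (Metric.closedBall (0 : E d) (Metric.diam Ω)) ^ (1 / p.toReal)).toNNReal

theorem poissonConstant_image (p : ℝ≥0∞) (T : E d ≃ᵢ E d) (Ω : Set (E d)) :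
    poissonConstant p (T '' Ω) = poissonConstant p Ω := by
  simp only [poissonConstant, T.isometry.diam_image]

theorem coe_poissonConstant (p : ℝ≥0∞) (Ω : Set (E d)) :
    (poissonConstant p Ω : ℝ≥0∞) = ENNReal.ofReal (1 + Metric.diam Ω ^ 2 / (2 * d)) *
      volume (Metric.closedBall (0 : E d) (Metric.diam Ω)) ^ (1 / p.toReal) :=
  ENNReal.coe_toNNReal <| ENNReal.mul_ne_top ENNReal.ofReal_ne_top
    (ENNReal.rpow_ne_top_of_nonneg (by positivity) measure_closedBall_lt_top.ne)

theorem eLpNorm_le_eLpNorm_top_mul_volume_closedBall (hb : Bornology.IsBounded Ω)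
    (hu : AEStronglyMeasurable u (volume.restrict Ω)) (p : ℝ≥0∞) :
    eLpNorm u p (volume.restrict Ω) ≤ eLpNorm u ∞ (volume.restrict Ω) *
      volume (Metric.closedBall (0 : E d) (Metric.diam Ω)) ^ (1 / p.toReal) := by
  refine (eLpNorm_le_eLpNorm_mul_rpow_measure_univ le_top hu).trans ?_
  rw [Measure.restrict_apply_univ, ENNReal.toReal_top, div_zero, sub_zero]
  gcongr _ * ?_ ^ _
  exact volume_le_volume_closedBall_diam hb

theorem MemSobolev.eLpNorm_le_poissonConstant_mul_dataNorm [NeZero d] (hΩ : IsOpen Ω)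
    (hb : Bornology.IsBounded Ω) (hlip : HasLipschitzBoundary Ω) (hu : MemSobolev Ω 1 ∞ u)
    (hweak : ∀ i, ∃ v, HasWeakDeriv Ω (Pi.single i 2) u v) (htrace : ∃ g, HasTrace Ω u g)
    (p : ℝ≥0∞) :
    eLpNorm u p (volume.restrict Ω) ≤ poissonConstant p Ω * dataNorm Ω u := by
  rw [coe_poissonConstant, mul_right_comm]
  refine (eLpNorm_le_eLpNorm_top_mul_volume_closedBall hb hu.memLp.1 p).trans ?_
  gcongr
  exact hu.eLpNorm_top_le_mul_dataNorm hΩ hb hlip hweak htrace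

end Estimate

end PoissonEstimate

end

open PoissonEstimate in
theorem mainTheorem2_general (d : ℕ) (hd : 1 ≤ d) (p : ℝ≥0∞) :
    ∃ C_P : Set (E d) → ℝ≥0,
      (∀ (T : E d ≃ᵢ E d) (Ω : Set (E d)), C_P (T '' Ω) = C_P Ω) ∧
      ∀ Ω : Set (E d), IsOpen Ω → Bornology.IsBounded Ω → HasLipschitzBoundary Ω →
        ∀ u : E d → ℝ, MemSobolev Ω 1 ∞ u → (∀ i, ∃ v, HasWeakDeriv Ω (Pi.single i 2) u v) →
          (∃ g, HasTrace Ω u g) → eLpNorm u p (volume.restrict Ω) ≤ C_P Ω * dataNorm Ω u := by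
  have : NeZero d := ⟨by lia⟩
  exact ⟨poissonConstant p, poissonConstant_image p, fun Ω hΩ hb hlip u hu hweak hg =>
    hu.eLpNorm_le_poissonConstant_mul_dataNorm hΩ hb hlip hweak hg p⟩

/-- The constant `C_P Ω` depends only on the shape and size of `Ω`: it is a function of the set
`Ω` alone, and it takes the same value at congruent sets. -/
theorem mainTheorem2 (d : ℕ) (hd : 1 ≤ d) :
    ∃ C_P : Set (PoissonEstimate.E d) → ℝ≥0,
      (∀ (T : PoissonEstimate.E d ≃ᵢ PoissonEstimate.E d) (Ω : Set (PoissonEstimate.E d)),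
        C_P (T '' Ω) = C_P Ω) ∧
      ∀ Ω : Set (PoissonEstimate.E d), PoissonEstimate.IsAdmissibleDomain Ω →
        ∀ m : ℕ, 2 ≤ m → ∀ f g u : PoissonEstimate.E d → ℝ,
          PoissonEstimate.MemSobolev Ω m ∞ u →
          PoissonEstimate.IsPoissonSolution Ω f g u →
            eLpNorm u 2 (volume.restrict Ω) ≤ C_P Ω * PoissonEstimate.dataNorm Ω u := by
  obtain ⟨C_P, hC_P, hle⟩ := mainTheorem2_general d hd 2
  exact ⟨C_P, hC_P, fun Ω hΩ m hm f g u hu hsol =>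
    hle Ω hΩ.isOpen hΩ.isBounded hΩ.lipschitz u (hu.mono (by lia))
      (fun i => (hu.deriv (Pi.single i 2) (by simpa using hm)).imp fun _ h => h.1)
      ⟨g, hsol.boundary⟩⟩
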